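/- Let $\mathbb{F}_q$ be a finite field and let $E/\mathbb{F}_q$ be an elliptic function field, i.e. an algebraic function field of one variable with full constant field $\mathbb{F}_q$, of genus one, together with a chosen rational place $O$ (a place is rational if it has degree one). The set $\mathbb{P}_E^1$ of rational places is a group with zero element $O$ under the addition $\oplus$ determined by: $P\oplus R=S$ if and only if the divisor $P+R-S-O$ is principal. Suppose that $E$ has exactly $q+1+t$ rational places, $t\in\mathbb{Z}$, and that $E$ is cyclic, i.e. the group $(\mathbb{P}_E^1,\oplus)$ is cyclic; let $P$ be a generator of this group, and let $\tau_P$ be an automorphism of $E$ over $\mathbb{F}_q$ which induces the translation by $P$ on the rational places, i.e. $\tau_P(R)=P\oplus R$ for every rational place $R$ of $E$. Let $d$ be a positive integer with $\gcd(d,q+1+t)=1$ and let $Q$ be a place of $E$ of degree $d$. Then, for $0\le j\le q+t$, the translates $\tau_P^j(Q)$ are pairwise distinct places of $E$ of degree $d$. -/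

import Mathlib

open scoped Pointwise

noncomputable section

/-- `E/K` is an algebraic function field (of one variable) with full constant field `K`: `E` is a
finite extension of `K(x)` for some `x ∈ E` transcendental over `K`, and every element of `E` which
is algebraic over `K` lies in `K`. -/
structure IsAlgFunctionField (K E : Type*) [Field K] [Field E] [Algebra K E] : Prop where
  finite_over_rational : ∃ x : E, Transcendental K x ∧
    FiniteDimensional (IntermediateField.adjoin K {x}) E
  full_constants : ∀ z : E, IsAlgebraic K z → z ∈ Set.range (algebraMap K E)

/-- A place of `E/K`, given by its valuation ring: a proper valuation subring of `E` that
contains `K`. -/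
@[ext]
structure Place (K E : Type*) [Field K] [Field E] [Algebra K E] where
  ring : ValuationSubring E
  algebraMap_mem : ∀ a : K, algebraMap K E a ∈ ring
  ne_top : ring ≠ ⊤

namespace Place

variable {K E : Type*} [Field K] [Field E] [Algebra K E]

instance (P : Place K E) : Algebra K P.ring :=
  ((algebraMap K E).codRestrict P.ring P.algebraMap_mem).toAlgebra

/-- The degree of a place: the dimension over `K` of its residue class field. -/
def degree (P : Place K E) : ℕ :=
  Module.finrank K (IsLocalRing.ResidueField P.ring)

open Classical in
/-- The normalized discrete valuation `ν_P(z)` of `z ≠ 0`. The valuation ring of a place of a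
function field is a discrete valuation ring, so the value of the second branch is immaterial.
Mathlib's adic valuation is multiplicative: it sends a uniformizer to `exp (-1)`. -/
def ord (P : Place K E) (z : E) : ℤ :=
  if _h : IsDiscreteValuationRing P.ring then
    -WithZero.log ((IsDiscreteValuationRing.maximalIdeal P.ring).valuation E z)
  else 0

theorem ord_one (P : Place K E) : P.ord 1 = 0 := by
  unfold ord
  split <;> simp

theorem ord_mul (P : Place K E) {y z : E} (hy : y ≠ 0) (hz : z ≠ 0) :
    P.ord (y * z) = P.ord y + P.ord z := by
  unfold ord
  split
  · rw [map_mul, WithZero.log_mul (by simpa using hy) (by simpa using hz)]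
    ring
  · simp

theorem ord_inv (P : Place K E) (z : E) : P.ord z⁻¹ = -P.ord z := by
  unfold ord
  split
  · rw [map_inv₀, WithZero.log_inv]
  · simp

theorem le_ord_add (P : Place K E) {n : ℤ} {y z : E} (hy : y ≠ 0) (hz : z ≠ 0) (hyz : y + z ≠ 0)
    (h1 : n ≤ P.ord y) (h2 : n ≤ P.ord z) : n ≤ P.ord (y + z) := by
  unfold ord at *
  split
  · rename_i h
    simp only [h, dite_true] at h1 h2
    rw [le_neg, WithZero.log_le_iff_le_exp (by simpa using hyz)]
    rw [le_neg, WithZero.log_le_iff_le_exp (by simpa using hy)] at h1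
    rw [le_neg, WithZero.log_le_iff_le_exp (by simpa using hz)] at h2
    exact Valuation.map_add_le _ h1 h2
  · rename_i h
    simpa only [h, dite_false] using h1

theorem ord_nonneg_of_mem (P : Place K E) {z : E} (hz : z ∈ P.ring) : 0 ≤ P.ord z := by
  unfold ord
  split
  · have h := (IsDiscreteValuationRing.maximalIdeal P.ring).valuation_le_one (K := E) ⟨z, hz⟩
    by_cases h0 : z = 0
    · simp [h0]
    · rw [le_neg, neg_zero, WithZero.log_le_iff_le_exp (by simpa using h0)]
      exact h
  · exact le_rfl

theorem ord_algebraMap (P : Place K E) (a : K) : P.ord (algebraMap K E a) = 0 := by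
  have h1 := P.ord_nonneg_of_mem (P.algebraMap_mem a)
  have h2 := P.ord_nonneg_of_mem (P.algebraMap_mem a⁻¹)
  rw [map_inv₀, ord_inv] at h2
  omega

/-- The action of `Aut(E/K)` on places: `σ(P)` is the image of `P` under `σ`. -/
instance : MulAction (E ≃ₐ[K] E) (Place K E) where
  smul σ P :=
    { ring := σ • P.ring
      algebraMap_mem := fun a => by
        rw [ValuationSubring.mem_smul_pointwise_iff_exists]
        exact ⟨algebraMap K E a, P.algebraMap_mem a, σ.commutes a⟩
      ne_top := fun h => P.ne_top <| by
        rw [eq_top_iff]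
        intro x _
        have hx : σ • x ∈ σ • P.ring := by rw [h]; trivial
        exact ValuationSubring.smul_mem_pointwise_smul_iff.mp hx }
  one_smul P := Place.ext (one_smul _ P.ring)
  mul_smul σ τ P := Place.ext (mul_smul σ τ P.ring)

end Place

section Divisors

variable (K E : Type*) [Field K] [Field E] [Algebra K E]

/-- The divisor group: the free abelian group on the places. -/
abbrev PlaceDivisor : Type _ := Place K E →₀ ℤ

/-- The degree homomorphism `∑ n_P P ↦ ∑ n_P deg P`. -/
def divisorDegree : PlaceDivisor K E →+ ℤ :=
  Finsupp.liftAddHom fun P => AddMonoidHom.mulRight (P.degree : ℤ)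

theorem divisorDegree_single (P : Place K E) (n : ℤ) :
    divisorDegree K E (Finsupp.single P n) = n * P.degree := by
  simp [divisorDegree]

/-- The group of divisors of degree zero. -/
abbrev degreeZeroDivisors : AddSubgroup (PlaceDivisor K E) := (divisorDegree K E).ker

/-- The group of principal divisors `(z) = ∑ ν_P(z) P`, `z ≠ 0`. -/
def principalDivisors : AddSubgroup (PlaceDivisor K E) where
  carrier := {D | ∃ z : E, z ≠ 0 ∧ ∀ P, D P = P.ord z}
  zero_mem' := ⟨1, one_ne_zero, fun P => by simp [Place.ord_one]⟩
  add_mem' := by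
    rintro A B ⟨y, hy, hA⟩ ⟨z, hz, hB⟩
    exact ⟨y * z, mul_ne_zero hy hz, fun P => by
      rw [Place.ord_mul P hy hz, Finsupp.add_apply, hA, hB]⟩
  neg_mem' := by
    rintro A ⟨z, hz, hA⟩
    exact ⟨z⁻¹, inv_ne_zero hz, fun P => by rw [Place.ord_inv, Finsupp.neg_apply, hA]⟩

/-- The group of divisor classes of degree zero. -/
abbrev ClassGroupZero : Type _ :=
  degreeZeroDivisors K E ⧸ (principalDivisors K E).addSubgroupOf (degreeZeroDivisors K E)

variable {K E}

/-- The Riemann-Roch space `L(G) = {z ≠ 0 : (z) + G ≥ 0} ∪ {0}`. -/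
def rrSpace (G : PlaceDivisor K E) : Submodule K E where
  carrier := {z | z ≠ 0 → ∀ P : Place K E, 0 ≤ P.ord z + G P}
  zero_mem' := fun h => absurd rfl h
  add_mem' := by
    intro y z hy hz hyz P
    by_cases hy0 : y = 0
    · subst hy0
      rw [zero_add] at hyz ⊢
      exact hz hyz P
    by_cases hz0 : z = 0
    · subst hz0
      rw [add_zero] at hyz ⊢
      exact hy hyz P
    have := P.le_ord_add (n := -G P) hy0 hz0 hyz (by linarith [hy hy0 P]) (by linarith [hz hz0 P])
    linarith
  smul_mem' := by
    intro a z hz haz P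
    have ha : algebraMap K E a ≠ 0 := by
      intro h
      exact haz (by rw [Algebra.smul_def, h, zero_mul])
    have hz0 : z ≠ 0 := by
      intro h
      exact haz (by rw [h, smul_zero])
    rw [Algebra.smul_def, P.ord_mul ha hz0, P.ord_algebraMap, zero_add]
    exact hz hz0 P

variable (K E)

/-- `E/K` has genus `g`: `g` is the maximum of `deg A - ℓ(A) + 1` over all divisors `A`, where
`ℓ(A)` is the dimension of the Riemann-Roch space `L(A)` over `K`. -/
def HasGenus (g : ℕ) : Prop :=
  IsGreatest
    (Set.range fun A : PlaceDivisor K E =>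
      divisorDegree K E A - (Module.finrank K (rrSpace A) : ℤ) + 1) (g : ℤ)

/-- A rational place: a place of degree one. -/
abbrev RationalPlace : Type _ := {P : Place K E // P.degree = 1}

/-- `E/K` is an algebraic function field with full constant field `K` and genus one. (An elliptic
function field consists of such an `E` and a chosen rational place `O`, its infinite place.) -/
structure IsGenusOneFunctionField : Prop extends IsAlgFunctionField K E where
  genus_one : HasGenus K E 1

end Divisors

namespace RationalPlace

variable {K E : Type*} [Field K] [Field E] [Algebra K E]

/-- The map `Φ : P ↦ [P - O]` from rational places to divisor classes of degree zero. -/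
def toClass (O P : RationalPlace K E) : ClassGroupZero K E :=
  QuotientAddGroup.mk
    ⟨Finsupp.single P.1 1 - Finsupp.single O.1 1, by
      rw [AddMonoidHom.mem_ker, map_sub, divisorDegree_single, divisorDegree_single, P.2, O.2,
        sub_self]⟩

/-- The addition `P ⊕ Q = Φ⁻¹(Φ(P) + Φ(Q))` of rational places, with zero element `O`
(in an elliptic function field the map `Φ` is bijective). -/
def add (O P Q : RationalPlace K E) : RationalPlace K E :=
  haveI : Nonempty (RationalPlace K E) := ⟨O⟩
  Function.invFun (toClass O) (toClass O P + toClass O Q)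

/-- The multiples `[0]P = O` and `[m + 1]P = [m]P ⊕ P`. -/
def multiple (O P : RationalPlace K E) : ℕ → RationalPlace K E
  | 0 => O
  | m + 1 => add O (multiple O P m) P

/-- `P` generates the group of rational places: each rational place is a multiple `[m]P`. (Over a
finite field this group is finite, so multiples with `m ≥ 0` suffice.) An elliptic function field is
cyclic if and only if such a `P` exists. -/
def IsGenerator (O P : RationalPlace K E) : Prop :=
  ∀ R : RationalPlace K E, ∃ m : ℕ, multiple O P m = R

/-- `τ` is an automorphism of `E/K` that induces the translation `R ↦ P ⊕ R` on the rational
places. -/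
def IsTranslation (O P : RationalPlace K E) (τ : E ≃ₐ[K] E) : Prop :=
  ∀ R : RationalPlace K E, τ • R.1 = (add O P R).1

end RationalPlace

end

/-! Translation by `P` shifts the divisor class of a place `Q` of degree `d` by `d[P - O]`. In genus
one `Q - (d-1)O`, of degree one, is equivalent to a rational place `R`; applying `τ` to `Q ~ R +
(d-1)O` gives `τQ ~ (P ⊕ R) + (d-1)P ~ Q + d(P - O)` (`IsTranslation.single_smul_sub_mem`). Hence
`τ^k Q = Q` forces `kd[P - O] = 0`. The class `[P - O]` generates a group of order `q+1+t`
(`IsGenerator.addOrderOf_toClass`), and `d` is prime to this order, so `q+1+t` divides `k`.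

The genus enters only through `deg A ≤ ℓ(A)`. Together with the vanishing of the degree of principal
divisors, it yields `exists_rationalPlace`. Underneath lies the fact that places are discrete
valuation rings with residue fields finite over `K`. -/

/-! ### Finiteness over `K(z)` -/

open Polynomial in
/-- If a family `v` is linearly independent over `K` modulo `z`, any relation among `v` with
coefficients polynomials in `z` is trivial. -/
theorem eq_zero_of_sum_aeval_mul_eq_zero {K R ι : Type*} [Field K] [CommRing R] [IsDomain R]
    [Algebra K R] [Fintype ι] {z : R} (hz : z ≠ 0) {v : ι → R}
    (hv : LinearIndependent K fun i => Ideal.Quotient.mk (Ideal.span {z}) (v i))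
    {p : ι → K[X]} (hp : ∑ i, aeval z (p i) * v i = 0) (i : ι) : p i = 0 := by
  -- Modulo `z` only the constant coefficients survive, so they vanish; dividing the relation by `z`
  -- then allows induction. Divisibility by every power of `X` contradicts the finite degree.
  have key : ∀ (k : ℕ) (p : ι → K[X]), ∑ i, aeval z (p i) * v i = 0 → ∀ i, X ^ k ∣ p i := by
    intro k
    induction k with
    | zero => intro p _ i; simp
    | succ k ih =>
      intro p hp
      have h0 : ∀ i, (p i).coeff 0 = 0 := by
        refine Fintype.linearIndependent_iff.mp hv (fun i => (p i).coeff 0) ?_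
        have h1 := congrArg (Ideal.Quotient.mk (Ideal.span {z})) hp
        rw [map_sum, map_zero] at h1
        rw [← h1]
        refine Finset.sum_congr rfl fun i _ => ?_
        have h2 : (Ideal.Quotient.mk (Ideal.span {z})) (aeval z (p i)) =
            algebraMap K _ ((p i).coeff 0) := by
          conv_lhs => rw [← divX_mul_X_add (p i)]
          rw [map_add, map_mul, aeval_X, aeval_C, map_add, map_mul,
            Ideal.Quotient.eq_zero_iff_mem.mpr (Ideal.mem_span_singleton_self z), mul_zero,
            zero_add]
          rfl
        rw [map_mul, h2, Algebra.smul_def]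
      have h1 : ∀ i, p i = divX (p i) * X := fun i => by
        conv_lhs => rw [← divX_mul_X_add (p i), h0 i, C_0, add_zero]
      have h2 : ∑ i, aeval z (divX (p i)) * v i = 0 := by
        refine (mul_eq_zero.mp ?_).resolve_left hz
        rw [← hp, Finset.mul_sum]
        refine Finset.sum_congr rfl fun i _ => ?_
        conv_rhs => rw [h1 i, map_mul, aeval_X]
        ring
      intro i
      rw [h1 i, pow_succ]
      exact mul_dvd_mul_right (ih _ h2 i) X
  by_contra hne
  have h1 := natDegree_le_of_dvd (key ((p i).natDegree + 1) p hp i) hne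
  rw [natDegree_X_pow] at h1
  omega

open scoped IntermediateField.algebraAdjoinAdjoin in
/-- A valuation ring of a field `E/K` has finite colength at `z ≠ 0` if `E` is finite over
`K(z)`. -/
theorem ValuationSubring.finite_quotient_span {K E : Type*} [Field K] [Field E] [Algebra K E]
    (V : ValuationSubring E) [Algebra K V] [IsScalarTower K V E] {z : V} (hz : z ≠ 0)
    [FiniteDimensional (IntermediateField.adjoin K {(z : E)}) E] :
    FiniteDimensional K (V ⧸ Ideal.span {z}) := by
  have hle : Module.rank K (V ⧸ Ideal.span {z}) ≤
      (Module.finrank (IntermediateField.adjoin K {(z : E)}) E : ℕ) := by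
    refine rank_le fun s hs => ?_
    choose v hv using fun i : s => Ideal.Quotient.mk_surjective (I := Ideal.span {z}) (i : V ⧸ _)
    have hv' : LinearIndependent K fun i => Ideal.Quotient.mk (Ideal.span {z}) (v i) := by
      simpa only [hv] using hs
    have hE : LinearIndependent (IntermediateField.adjoin K {(z : E)}) fun i => (v i : E) := by
      -- Clearing denominators reduces independence over `K(z)` to independence over `K[z]`.
      rw [← LinearIndependent.iff_fractionRing (R := Algebra.adjoin K {(z : E)}),
        Fintype.linearIndependent_iff]
      intro g hg
      have hmem : ∀ i, ∃ p : Polynomial K, Polynomial.aeval (z : E) p = (g i : E) := fun i => by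
        exact (AlgHom.mem_range _).mp
          ((Algebra.adjoin_singleton_eq_range_aeval K (z : E)).le (g i).2)
      choose p hp using hmem
      have hsum : ∑ i, Polynomial.aeval z (p i) * v i = 0 := by
        apply Subtype.val_injective
        have h1 : ∀ q : Polynomial K, ((Polynomial.aeval z q : V) : E) =
            Polynomial.aeval (z : E) q := fun q =>
          (Polynomial.aeval_algebraMap_apply E z q).symm
        rw [← hg.trans (show (0 : E) = ((0 : V) : E) from rfl)]
        push_cast
        refine Finset.sum_congr rfl fun i _ => ?_
        rw [h1, hp]
        rfl
      intro i
      apply Subtype.val_injective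
      rw [← hp i, eq_zero_of_sum_aeval_mul_eq_zero hz hv' hsum i, map_zero]
      rfl
    simpa using hE.fintype_card_le_finrank
  exact Module.rank_lt_aleph0_iff.mp (hle.trans_lt (Cardinal.natCast_lt_aleph0))

namespace IsAlgFunctionField

variable {K E : Type*} [Field K] [Field E] [Algebra K E]

-- The transcendence degree is at most one, so `z` alone is a transcendence basis; an algebraic
-- extension that is essentially of finite type is finite.
open scoped IntermediateField.algebraAdjoinAdjoin in
theorem finite_adjoin (h : IsAlgFunctionField K E) {z : E} (hz : Transcendental K z) :
    FiniteDimensional (IntermediateField.adjoin K {z}) E := by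
  obtain ⟨x, hx, hfin⟩ := h.finite_over_rational
  have : Algebra.EssFiniteType K (IntermediateField.adjoin K {x}) :=
    IntermediateField.essFiniteType_iff.mpr (IntermediateField.fg_adjoin_of_finite (by simp))
  have : Algebra.EssFiniteType K E :=
    Algebra.EssFiniteType.comp K (IntermediateField.adjoin K {x}) E
  have : Algebra.EssFiniteType (IntermediateField.adjoin K {z}) E :=
    Algebra.EssFiniteType.of_comp K _ E
  have halg : Algebra.IsAlgebraic (Algebra.adjoin K {x}) E :=
    (IsFractionRing.comap_isAlgebraic_iff (K := IntermediateField.adjoin K {x})).mpr inferInstance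
  have hdeg : Algebra.trdeg K E ≤ Cardinal.mk ({z} : Set E) := by
    rw [Cardinal.mk_singleton, ← Cardinal.mk_singleton x]
    exact Algebra.IsAlgebraic.trdeg_le_cardinalMk K {x}
  have hb : IsTranscendenceBasis K ((↑) : ({z} : Set E) → E) := by
    refine AlgebraicIndependent.isTranscendenceBasis_of_trdeg_le_of_finite ?_ hdeg
    exact (algebraicIndependent_unique_type_iff (x := ((↑) : ({z} : Set E) → E))).mpr hz
  have := hb.isAlgebraic_field
  rw [Subtype.range_coe] at this
  exact Algebra.finite_of_essFiniteType_of_isAlgebraic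
end IsAlgFunctionField

/-! ### Places, their valuations and the action of automorphisms -/

namespace Place

variable {K E : Type*} [Field K] [Field E] [Algebra K E]

instance (P : Place K E) : IsScalarTower K P.ring E := IsScalarTower.of_algebraMap_eq fun _ => rfl

theorem transcendental (h : IsAlgFunctionField K E) (P : Place K E) {z : P.ring} (hz : z ≠ 0)
    (hu : ¬ IsUnit z) : Transcendental K (z : E) := by
  intro halg
  obtain ⟨a, ha⟩ := h.full_constants _ halg
  have ha' : z = algebraMap K P.ring a := Subtype.ext ha.symm
  refine hu (ha' ▸ (IsUnit.mk0 a ?_).map (algebraMap K P.ring))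
  rintro rfl
  exact hz (by simpa using ha')

theorem finite_quotient (h : IsAlgFunctionField K E) (P : Place K E) {z : P.ring} (hz : z ≠ 0) :
    FiniteDimensional K (P.ring ⧸ Ideal.span {z}) := by
  by_cases hu : IsUnit z
  · rw [Ideal.span_singleton_eq_top.mpr hu]
    have : Subsingleton (P.ring ⧸ (⊤ : Ideal P.ring)) := Ideal.Quotient.subsingleton_iff.mpr rfl
    infer_instance
  · have := h.finite_adjoin (P.transcendental h hz hu)
    exact P.ring.finite_quotient_span hz

theorem exists_nonunit (P : Place K E) : ∃ z : P.ring, z ≠ 0 ∧ ¬ IsUnit z := by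
  by_contra! hc
  refine P.ne_top (eq_top_iff.mpr fun x _ => ?_)
  rcases P.ring.mem_or_inv_mem x with hx | hx
  · exact hx
  · by_cases h0 : x = 0
    · rw [h0]; exact P.ring.zero_mem
    · obtain ⟨u, hu⟩ := hc ⟨x⁻¹, hx⟩ fun h => inv_ne_zero h0 (congrArg Subtype.val h)
      have h1 : ((u⁻¹ : P.ringˣ) : P.ring) * u = 1 := by simp
      rw [hu] at h1
      have h2 : (((u⁻¹ : P.ringˣ) : P.ring) : E) * x⁻¹ = 1 := congrArg Subtype.val h1
      rw [mul_inv_eq_one₀ h0] at h2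
      exact h2 ▸ Subtype.property _

/-- An ideal containing `z ≠ 0` is finitely generated because the ring modulo `z` is
finite-dimensional over `K`; a Noetherian valuation ring that is not a field is discrete. -/
theorem isDiscreteValuationRing (h : IsAlgFunctionField K E) (P : Place K E) :
    IsDiscreteValuationRing P.ring := by
  have hN : IsNoetherianRing P.ring := by
    refine (isNoetherianRing_iff_ideal_fg _).mpr fun I => ?_
    by_cases hI : I = ⊥
    · exact hI ▸ Submodule.fg_bot
    obtain ⟨z, hzI, hz⟩ := Submodule.exists_mem_ne_zero_of_ne_bot hI
    have := P.finite_quotient h hz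
    refine Submodule.fg_of_fg_map_of_fg_inf_ker (Submodule.mkQ (Ideal.span {z})) ?_ ?_
    · have : IsNoetherian P.ring (P.ring ⧸ Ideal.span {z}) :=
        isNoetherian_of_tower K inferInstance
      exact IsNoetherian.noetherian _
    · rw [Submodule.ker_mkQ, inf_eq_right.mpr ((Ideal.span_singleton_le_iff_mem I).mpr hzI)]
      exact Submodule.fg_span_singleton z
  obtain ⟨z, hz, hu⟩ := P.exists_nonunit
  have hf : ¬ IsField P.ring := by
    intro hf
    refine hu ?_
    obtain ⟨b, hb⟩ := hf.mul_inv_cancel hz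
    exact IsUnit.of_mul_eq_one b hb
  exact ((IsDiscreteValuationRing.TFAE P.ring hf).out 0 1).mpr (inferInstance : ValuationRing P.ring)

/-- The content is finite-dimensionality of the residue field, since `finrank` would otherwise be 0.
-/
theorem degree_pos (h : IsAlgFunctionField K E) (P : Place K E) : 0 < P.degree := by
  obtain ⟨z, hz, hu⟩ := P.exists_nonunit
  have := P.finite_quotient h hz
  have hle : Ideal.span {z} ≤ IsLocalRing.maximalIdeal P.ring :=
    (Ideal.span_singleton_le_iff_mem _).mpr hu
  have : FiniteDimensional K (IsLocalRing.ResidueField P.ring) :=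
    Module.Finite.of_surjective (Ideal.Quotient.factorₐ K (I := Ideal.span {z}) (J := IsLocalRing.maximalIdeal P.ring) hle).toLinearMap
      (Ideal.Quotient.factor_surjective hle)
  exact Module.finrank_pos

theorem ord_nonneg_iff (h : IsAlgFunctionField K E) (P : Place K E) {z : E} (hz : z ≠ 0) :
    0 ≤ P.ord z ↔ z ∈ P.ring := by
  refine ⟨fun h0 => ?_, P.ord_nonneg_of_mem⟩
  have hD := P.isDiscreteValuationRing h
  unfold ord at h0
  rw [dif_pos hD, le_neg, neg_zero, WithZero.log_le_iff_le_exp (by simpa using hz)] at h0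
  obtain ⟨a, rfl⟩ := IsDiscreteValuationRing.exists_lift_of_le_one h0
  exact a.2

theorem exists_ord_eq_one (h : IsAlgFunctionField K E) (P : Place K E) :
    ∃ z : E, z ≠ 0 ∧ P.ord z = 1 := by
  have hD := P.isDiscreteValuationRing h
  obtain ⟨z, hz⟩ :=
    (IsDiscreteValuationRing.maximalIdeal P.ring).valuation_exists_uniformizer E
  refine ⟨z, ?_, ?_⟩
  · rintro rfl
    exact WithZero.exp_ne_zero ((map_zero _).symm.trans hz).symm
  · unfold ord
    rw [dif_pos hD, hz]
    simp

theorem ord_zpow (P : Place K E) {z : E} (hz : z ≠ 0) (n : ℤ) : P.ord (z ^ n) = n * P.ord z := by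
  have hnat : ∀ m : ℕ, P.ord (z ^ m) = m * P.ord z := fun m => by
    induction m with
    | zero => simp [ord_one]
    | succ m ih => rw [pow_succ, P.ord_mul (pow_ne_zero m hz) hz, ih]; push_cast; ring
  obtain ⟨m, rfl | rfl⟩ := n.eq_nat_or_neg
  · simpa using hnat m
  · rw [zpow_neg, ord_inv, zpow_natCast, hnat]; ring

theorem smul_mem_smul_iff (τ : E ≃ₐ[K] E) (P : Place K E) {z : E} :
    τ z ∈ (τ • P).ring ↔ z ∈ P.ring :=
  ValuationSubring.smul_mem_pointwise_smul_iff (g := τ)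

/-- Both valuations have the same valuation ring on `E`, hence are proportional; both take the value
1, so the factor is 1. -/
theorem ord_smul (h : IsAlgFunctionField K E) (τ : E ≃ₐ[K] E) (P : Place K E) {z : E}
    (hz : z ≠ 0) : (τ • P).ord (τ z) = P.ord z := by
  have hτ : ∀ {y : E}, y ≠ 0 → τ y ≠ 0 := fun hy => by simpa using hy
  have hnn : ∀ {y : E}, y ≠ 0 → (0 ≤ (τ • P).ord (τ y) ↔ 0 ≤ P.ord y) := fun hy => by
    rw [ord_nonneg_iff h _ (hτ hy), ord_nonneg_iff h _ hy, smul_mem_smul_iff]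
  have hzero : ∀ {y : E}, y ≠ 0 → P.ord y = 0 → (τ • P).ord (τ y) = 0 := fun {y} hy h0 => by
    have h1 := (hnn hy).mpr h0.ge
    have h2 := (hnn (inv_ne_zero hy)).mpr (by rw [ord_inv, h0, neg_zero])
    rw [map_inv₀, ord_inv] at h2
    omega
  obtain ⟨u, hu0, hu⟩ := P.exists_ord_eq_one h
  have hval : ∀ {y : E}, y ≠ 0 → (τ • P).ord (τ y) = P.ord y * (τ • P).ord (τ u) := by
    intro y hy
    have h1 := hzero (mul_ne_zero hy (zpow_ne_zero (-P.ord y) hu0)) (by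
      rw [P.ord_mul hy (zpow_ne_zero _ hu0), P.ord_zpow hu0, hu]; ring)
    rw [map_mul, map_zpow₀, ord_mul _ (hτ hy) (zpow_ne_zero _ (hτ hu0)),
      ord_zpow _ (hτ hu0)] at h1
    linarith
  have hpos : 0 ≤ (τ • P).ord (τ u) := (hnn hu0).mpr (by omega)
  obtain ⟨w, hw0, hw⟩ := (τ • P).exists_ord_eq_one h
  have hw' := hval (y := τ.symm w) (by simpa using hw0)
  rw [AlgEquiv.apply_symm_apply, hw] at hw'
  have : (τ • P).ord (τ u) = 1 :=
    Int.eq_one_of_dvd_one hpos ⟨_, hw'.trans (mul_comm _ _)⟩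
  rw [hval hz, this, mul_one]

theorem degree_smul (τ : E ≃ₐ[K] E) (P : Place K E) : (τ • P).degree = P.degree := by
  let e : P.ring ≃ₐ[K] (τ • P).ring := AlgEquiv.ofBijective
    { toFun := fun z => ⟨τ z, (smul_mem_smul_iff τ P).mpr z.2⟩
      map_one' := Subtype.ext (map_one τ)
      map_mul' := fun _ _ => Subtype.ext (map_mul τ _ _)
      map_zero' := Subtype.ext (map_zero τ)
      map_add' := fun _ _ => Subtype.ext (map_add τ _ _)
      commutes' := fun a => Subtype.ext (τ.commutes a) }
    ⟨fun x y hxy => Subtype.ext (τ.injective (congrArg Subtype.val hxy)), fun y => by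
      have hy : τ (τ.symm y) = y := τ.apply_symm_apply _
      exact ⟨⟨τ.symm y, (smul_mem_smul_iff τ P).mp (by rw [hy]; exact y.2)⟩, Subtype.ext hy⟩⟩
  exact (IsLocalRing.ResidueField.mapAlgEquiv e).toLinearEquiv.finrank_eq.symm

/-- A nonconstant function has a pole. -/
theorem exists_notMem_ring {z : E} (hz : ¬ IsAlgebraic K z) : ∃ P : Place K E, z ∉ P.ring := by
  have hmem : z ∉
      (integralClosure (Subring.closure ((⊥ : Subalgebra K E) : Set E)) E).toSubring := by
    rw [← Subalgebra.coe_toSubring, Subring.closure_eq]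
    intro hz'
    have hz'' : IsIntegral (⊥ : Subalgebra K E) z := hz'
    exact hz (isIntegral_trans z hz'').isAlgebraic
  -- The integral closure of `K` is the intersection of the valuation rings containing it, so one of
  -- these misses `z`.
  rw [← iInf_valuationSubring_superset] at hmem
  simp only [Subring.mem_iInf, not_forall] at hmem
  obtain ⟨V, hV⟩ := hmem
  exact ⟨⟨V.1, fun a => V.2 (Subalgebra.algebraMap_mem _ a), fun h => hV (h ▸ trivial)⟩, hV⟩

end Place

/-! ### Divisors, and the consequences of genus one -/

section Divisors

variable {K E : Type*} [Field K] [Field E] [Algebra K E]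

theorem divisorDegree_apply (D : PlaceDivisor K E) :
    divisorDegree K E D = D.sum fun P n => n * (P.degree : ℤ) := by
  simp [divisorDegree, Finsupp.liftAddHom_apply]

namespace IsAlgFunctionField

variable (h : IsAlgFunctionField K E)
include h

/-- Nonconstant functions have poles, so only constants remain. -/
theorem finite_rrSpace_zero : FiniteDimensional K (rrSpace (0 : PlaceDivisor K E)) := by
  have hle : rrSpace (0 : PlaceDivisor K E) ≤ LinearMap.range (Algebra.linearMap K E) := by
    intro z hz
    by_cases h0 : z = 0
    · exact h0 ▸ Submodule.zero_mem _
    by_contra hc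
    have hna : ¬ IsAlgebraic K z := fun ha => hc (h.full_constants z ha)
    obtain ⟨P, hP⟩ := Place.exists_notMem_ring hna
    exact hP ((P.ord_nonneg_iff h h0).mp (by simpa using hz h0 P))
  exact Submodule.finiteDimensional_of_le hle

theorem eq_zero_of_divisorDegree_nonpos {D : PlaceDivisor K E} (hD : ∀ P, 0 ≤ D P)
    (hdeg : divisorDegree K E D ≤ 0) : D = 0 := by
  ext P
  by_contra hP
  have hPs : P ∈ D.support := Finsupp.mem_support_iff.mpr hP
  have h1 : 0 < D P * (P.degree : ℤ) :=
    mul_pos (lt_of_le_of_ne (hD P) (Ne.symm hP)) (by exact_mod_cast P.degree_pos h)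
  have h2 : D P * (P.degree : ℤ) ≤ divisorDegree K E D := by
    rw [divisorDegree_apply, Finsupp.sum]
    exact Finset.single_le_sum (f := fun P => D P * (P.degree : ℤ))
      (fun R _ => mul_nonneg (hD R) (Int.natCast_nonneg _)) hPs
  omega

/-- An effective divisor of degree one is a rational place. -/
theorem exists_eq_single {D : PlaceDivisor K E} (hD : ∀ P, 0 ≤ D P)
    (hdeg : divisorDegree K E D = 1) : ∃ R : RationalPlace K E, D = Finsupp.single R.1 1 := by
  have h0 : D ≠ 0 := by
    rintro rfl
    simp at hdeg
  obtain ⟨P, hP⟩ := Finsupp.ne_iff.mp h0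
  have hP1 : 1 ≤ D P := lt_of_le_of_ne (hD P) (Ne.symm hP)
  have hpos := P.degree_pos h
  have hsub : D - Finsupp.single P 1 = 0 := by
    refine h.eq_zero_of_divisorDegree_nonpos (fun R => ?_) ?_
    · by_cases hR : R = P
      · subst hR; simpa using hP1
      · simpa [Finsupp.single_apply, Ne.symm hR] using hD R
    · rw [map_sub, divisorDegree_single, hdeg]
      omega
  rw [sub_eq_zero] at hsub
  rw [hsub, divisorDegree_single] at hdeg
  exact ⟨⟨P, by omega⟩, hsub⟩

theorem mapDomain_mem_principalDivisors (τ : E ≃ₐ[K] E) {D : PlaceDivisor K E}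
    (hD : D ∈ principalDivisors K E) :
    Finsupp.mapDomain (τ • ·) D ∈ principalDivisors K E := by
  obtain ⟨z, hz, hD⟩ := hD
  refine ⟨τ z, by simpa using hz, fun P => ?_⟩
  obtain ⟨R, rfl⟩ := MulAction.surjective τ P
  rw [Finsupp.mapDomain_apply (MulAction.injective τ), hD, Place.ord_smul h τ R hz]

end IsAlgFunctionField

namespace IsGenusOneFunctionField

variable (h : IsGenusOneFunctionField K E)
include h

theorem divisorDegree_le_finrank (A : PlaceDivisor K E) :
    divisorDegree K E A ≤ Module.finrank K (rrSpace A) := by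
  have := h.genus_one.2 ⟨A, rfl⟩
  push_cast at this
  linarith

/-- A divisor bounded above by the divisor of a function has degree at most zero. -/
theorem divisorDegree_nonpos {z : E} (hz : z ≠ 0) {D : PlaceDivisor K E}
    (hD : ∀ P, D P ≤ P.ord z) : divisorDegree K E D ≤ 0 := by
  have := h.toIsAlgFunctionField.finite_rrSpace_zero
  -- Multiplication by `z ^ n` embeds `L(nD)` into `L(0)`, so `n deg D` stays bounded as `n` grows.
  have key : ∀ n : ℕ, n * divisorDegree K E D ≤
      Module.finrank K (rrSpace (0 : PlaceDivisor K E)) := fun n => by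
    have hzn : z ^ n ≠ 0 := pow_ne_zero n hz
    have hmul : ∀ f ∈ rrSpace (n • D), LinearMap.mulRight K (z ^ n) f ∈
        rrSpace (0 : PlaceDivisor K E) := fun f hf h0 P => by
      have hf0 : f ≠ 0 := by
        rintro rfl
        simp at h0
      have h1 := hf hf0 P
      have h2 := P.ord_zpow hz n
      rw [zpow_natCast] at h2
      rw [LinearMap.mulRight_apply, P.ord_mul hf0 hzn, h2]
      simp only [Finsupp.coe_smul, Pi.smul_apply, nsmul_eq_mul, Finsupp.coe_zero,
        Pi.zero_apply] at h1 ⊢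
      nlinarith [mul_le_mul_of_nonneg_left (hD P) (Int.natCast_nonneg n)]
    have hle := LinearMap.finrank_le_finrank_of_injective
      (f := (LinearMap.mulRight K (z ^ n)).restrict hmul) (fun x y hxy => Subtype.ext
        (mul_right_cancel₀ hzn (congrArg Subtype.val hxy)))
    have h1 := h.divisorDegree_le_finrank (n • D)
    rw [map_nsmul, nsmul_eq_mul] at h1
    exact h1.trans (by exact_mod_cast hle)
  by_contra! hc
  have h1 := key (Module.finrank K (rrSpace (0 : PlaceDivisor K E)) + 1)
  push_cast at h1
  nlinarith

/-- A function whose poles are bounded by a divisor has finitely many zeros and poles. -/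
theorem exists_divisor_of_mem_rrSpace {z : E} (hz : z ≠ 0) {A : PlaceDivisor K E}
    (hA : z ∈ rrSpace A) : ∃ D : PlaceDivisor K E, ∀ P, D P = P.ord z := by
  classical
  have hfin : {P : Place K E | P.ord z + A P ≠ 0}.Finite := by
    by_contra hinf
    -- With more than `deg A` places in `S`, the divisor `∑ S - A` lies below that of `z` yet has
    -- positive degree.
    obtain ⟨S, hS, hcard⟩ :=
      Set.Infinite.exists_subset_card_eq hinf ((divisorDegree K E A).toNat + 1)
    have hle := h.divisorDegree_nonpos hz (D := (∑ P ∈ S, Finsupp.single P 1) - A) fun P => by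
      have h0 := hA hz P
      by_cases hP : P ∈ S
      · have h1 : P.ord z + A P ≠ 0 := hS hP
        simp [Finsupp.single_apply, hP]
        omega
      · simp [Finsupp.single_apply, hP]
        omega
    rw [map_sub, map_sum] at hle
    have hsum : (S.card : ℤ) ≤ ∑ P ∈ S, divisorDegree K E (Finsupp.single P 1) := by
      rw [Finset.card_eq_sum_ones, Nat.cast_sum]
      refine Finset.sum_le_sum fun P _ => ?_
      have := P.degree_pos h.toIsAlgFunctionField
      rw [divisorDegree_single]
      push_cast
      omega
    omega
  refine ⟨Finsupp.onFinset (hfin.toFinset ∪ A.support) (fun P => P.ord z) fun P hP => ?_,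
    fun P => Finsupp.onFinset_apply⟩
  rw [Finset.mem_union, Set.Finite.mem_toFinset, Finsupp.mem_support_iff, Set.mem_ofPred_eq]
  by_contra! hc
  exact hP (by simpa [hc.2] using hc.1)

theorem divisorDegree_eq_zero {D : PlaceDivisor K E} (hD : D ∈ principalDivisors K E) :
    divisorDegree K E D = 0 := by
  have hle : ∀ {C : PlaceDivisor K E}, C ∈ principalDivisors K E → divisorDegree K E C ≤ 0 := by
    rintro C ⟨z, hz, hC⟩
    exact h.divisorDegree_nonpos hz fun P => (hC P).le
  have h1 := hle ((principalDivisors K E).neg_mem hD)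
  rw [map_neg] at h1
  exact le_antisymm (hle hD) (by linarith)

/-- Every divisor of degree one is linearly equivalent to a rational place. -/
theorem exists_rationalPlace {A : PlaceDivisor K E} (hA : divisorDegree K E A = 1) :
    ∃ R : RationalPlace K E, Finsupp.single R.1 1 - A ∈ principalDivisors K E := by
  have hpos : 0 < Module.finrank K (rrSpace A) := by
    have := h.divisorDegree_le_finrank A
    omega
  have := Module.nontrivial_of_finrank_pos hpos
  obtain ⟨⟨z, hzA⟩, hz⟩ := exists_ne (0 : rrSpace A)
  have hz0 : z ≠ 0 := fun h0 => hz (Subtype.ext h0)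
  obtain ⟨D, hD⟩ := h.exists_divisor_of_mem_rrSpace hz0 hzA
  have hDp : D ∈ principalDivisors K E := ⟨z, hz0, hD⟩
  obtain ⟨R, hR⟩ := h.toIsAlgFunctionField.exists_eq_single (D := D + A)
    (fun P => by rw [Finsupp.add_apply, hD]; exact hzA hz0 P)
    (by rw [map_add, h.divisorDegree_eq_zero hDp, hA, zero_add])
  exact ⟨R, by rwa [← hR, add_sub_cancel_right]⟩

end IsGenusOneFunctionField

end Divisors

/-! ### Rational places, divisor classes and translations -/

namespace RationalPlace

variable {K E : Type*} [Field K] [Field E] [Algebra K E]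

theorem toClass_surjective (h : IsGenusOneFunctionField K E) (O : RationalPlace K E) :
    Function.Surjective (toClass O) := by
  intro c
  obtain ⟨⟨D, hD⟩, rfl⟩ := QuotientAddGroup.mk_surjective c
  obtain ⟨R, hR⟩ := h.exists_rationalPlace (A := D + Finsupp.single O.1 1) (by
    rw [map_add, divisorDegree_single, O.2, AddMonoidHom.mem_ker.mp hD]
    norm_num)
  refine ⟨R, ?_⟩
  rw [toClass, eq_comm, QuotientAddGroup.eq, AddSubgroup.mem_addSubgroupOf]
  convert hR using 1
  simp only [AddSubgroup.coe_add, NegMemClass.coe_neg]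
  abel

theorem toClass_add (h : IsGenusOneFunctionField K E) (O P R : RationalPlace K E) :
    toClass O (add O P R) = toClass O P + toClass O R :=
  haveI : Nonempty (RationalPlace K E) := ⟨O⟩
  Function.invFun_eq (toClass_surjective h O _)

theorem toClass_self (O : RationalPlace K E) : toClass O O = 0 := by
  rw [toClass, QuotientAddGroup.eq_zero_iff, AddSubgroup.mem_addSubgroupOf]
  simp

theorem toClass_multiple (h : IsGenusOneFunctionField K E) (O P : RationalPlace K E) (m : ℕ) :
    toClass O (multiple O P m) = m • toClass O P := by
  induction m with
  | zero => rw [multiple, toClass_self, zero_nsmul]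
  | succ m ih => rw [multiple, toClass_add h, ih, succ_nsmul]

/-- The relation `P ⊕ R ~ P + R - O` of divisors. -/
theorem single_add_sub_mem (h : IsGenusOneFunctionField K E) (O P R : RationalPlace K E) :
    Finsupp.single (add O P R).1 1 - Finsupp.single R.1 1 -
      (Finsupp.single P.1 1 - Finsupp.single O.1 1) ∈ principalDivisors K E := by
  have h1 := (toClass_add h O P R).symm
  rw [toClass, toClass, toClass, ← QuotientAddGroup.mk_add, QuotientAddGroup.eq,
    AddSubgroup.mem_addSubgroupOf] at h1
  convert h1 using 1
  simp only [AddSubgroup.coe_add, NegMemClass.coe_neg]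
  abel

theorem nsmul_toClass_eq_zero_iff (O P : RationalPlace K E) (n : ℕ) :
    n • toClass O P = 0 ↔
      n • (Finsupp.single P.1 1 - Finsupp.single O.1 1) ∈ principalDivisors K E := by
  rw [toClass, ← QuotientAddGroup.mk_nsmul, QuotientAddGroup.eq_zero_iff,
    AddSubgroup.mem_addSubgroupOf]
  rfl

/-- A translation acts injectively on rational places, so rational places in the same class
coincide. -/
theorem IsTranslation.toClass_injective {O P : RationalPlace K E} {τ : E ≃ₐ[K] E}
    (hτ : IsTranslation O P τ) : Function.Injective (toClass O) := by
  intro R S hRS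
  refine Subtype.ext (MulAction.injective τ ?_)
  change τ • R.1 = τ • S.1
  -- The sum `P ⊕ R` depends on `R` only through its class.
  rw [hτ R, hτ S, add, add, hRS]

/-- `Φ` is a bijection carrying multiples of `P` to multiples of its class, which therefore exhaust
the class group. -/
theorem IsGenerator.addOrderOf_toClass (h : IsGenusOneFunctionField K E) {O P : RationalPlace K E}
    (hP : IsGenerator O P) {τ : E ≃ₐ[K] E} (hτ : IsTranslation O P τ) :
    addOrderOf (toClass O P) = Nat.card (RationalPlace K E) := by
  rw [Nat.card_congr (Equiv.ofBijective _ ⟨hτ.toClass_injective, toClass_surjective h O⟩)]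
  refine addOrderOf_eq_card_of_forall_mem_multiples fun c => ?_
  obtain ⟨R, rfl⟩ := toClass_surjective h O c
  obtain ⟨m, rfl⟩ := hP R
  exact ⟨m, (toClass_multiple h O P m).symm⟩

/-- The translation by `P` moves a place of degree `d` by the class of `d (P - O)`. -/
theorem IsTranslation.single_smul_sub_mem (h : IsGenusOneFunctionField K E)
    {O P : RationalPlace K E} {τ : E ≃ₐ[K] E} (hτ : IsTranslation O P τ) (Q : Place K E) :
    Finsupp.single (τ • Q) 1 - Finsupp.single Q 1 -
      Q.degree • (Finsupp.single P.1 1 - Finsupp.single O.1 1) ∈ principalDivisors K E := by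
  obtain ⟨R, hR⟩ := h.exists_rationalPlace
      (A := Finsupp.single Q 1 - ((Q.degree : ℤ) - 1) • Finsupp.single O.1 1) (by
    rw [map_sub, map_zsmul, divisorDegree_single, divisorDegree_single, O.2, smul_eq_mul]
    push_cast
    ring)
  have hτR := h.toIsAlgFunctionField.mapDomain_mem_principalDivisors τ hR
  rw [← Finsupp.mapDomain.addMonoidHom_apply] at hτR
  simp only [map_sub, map_zsmul, Finsupp.mapDomain.addMonoidHom_apply, Finsupp.mapDomain_single,
    hτ R, hτ O] at hτR
  have hO := single_add_sub_mem h O P O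
  have hPR := single_add_sub_mem h O P R
  have hO' := (principalDivisors K E).zsmul_mem hO ((Q.degree : ℤ) - 1)
  -- With `d` the degree of `Q`, the places `R` and `P ⊕ R` cancel; `hPR` contributes one copy of `P
  -- - O`, and `hO'` the other `d - 1`.
  have := (principalDivisors K E).add_mem (add_mem (sub_mem hR hτR) hPR) hO'
  convert this using 1
  rw [← natCast_zsmul]
  module

theorem IsTranslation.single_pow_smul_sub_mem (h : IsGenusOneFunctionField K E)
    {O P : RationalPlace K E} {τ : E ≃ₐ[K] E} (hτ : IsTranslation O P τ) (Q : Place K E)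
    (k : ℕ) :
    Finsupp.single (τ ^ k • Q) 1 - Finsupp.single Q 1 -
      (k * Q.degree) • (Finsupp.single P.1 1 - Finsupp.single O.1 1) ∈
        principalDivisors K E := by
  induction k with
  | zero => simp
  | succ k ih =>
    have h1 := hτ.single_smul_sub_mem h (τ ^ k • Q)
    rw [Place.degree_smul, smul_smul, ← pow_succ'] at h1
    convert add_mem h1 ih using 1
    rw [add_mul, one_mul, add_smul]
    abel

/-- If a power of the translation by a generator fixes a place of degree prime to the number of
rational places, then the exponent is a multiple of that number. -/
theorem IsTranslation.card_dvd_of_pow_smul_eq (h : IsGenusOneFunctionField K E)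
    {O P : RationalPlace K E} (hP : IsGenerator O P) {τ : E ≃ₐ[K] E} (hτ : IsTranslation O P τ)
    {Q : Place K E} (hQ : Nat.Coprime (Nat.card (RationalPlace K E)) Q.degree) {k : ℕ}
    (hk : τ ^ k • Q = Q) : Nat.card (RationalPlace K E) ∣ k := by
  have h1 := hτ.single_pow_smul_sub_mem h Q k
  rw [hk, sub_self, zero_sub, neg_mem_iff, ← nsmul_toClass_eq_zero_iff,
    ← addOrderOf_dvd_iff_nsmul_eq_zero, hP.addOrderOf_toClass h hτ] at h1
  exact hQ.dvd_of_dvd_mul_right h1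

end RationalPlace

theorem proposition3p1 {K E : Type*} [Field K] [Fintype K] [Field E] [Algebra K E]
    (hE : IsGenusOneFunctionField K E) (O : RationalPlace K E)
    (t : ℤ) (hN : (Nat.card (RationalPlace K E) : ℤ) = (Fintype.card K : ℤ) + 1 + t)
    (P : RationalPlace K E) (hP : RationalPlace.IsGenerator O P)
    (τ : E ≃ₐ[K] E) (hτ : RationalPlace.IsTranslation O P τ)
    (d : ℕ) (hd : 0 < d) (Q : Place K E) (hQ : Q.degree = d)
    (hgcd : Int.gcd (d : ℤ) ((Fintype.card K : ℤ) + 1 + t) = 1) :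
    (∀ j : ℕ, (j : ℤ) ≤ (Fintype.card K : ℤ) + t → (τ ^ j • Q).degree = d) ∧
      ∀ i j : ℕ, (i : ℤ) ≤ (Fintype.card K : ℤ) + t → (j : ℤ) ≤ (Fintype.card K : ℤ) + t →
        i ≠ j → τ ^ i • Q ≠ τ ^ j • Q := by
  refine ⟨fun j _ => (Place.degree_smul _ Q).trans hQ, fun i j hi hj hij heq => ?_⟩
  have hcop : Nat.Coprime (Nat.card (RationalPlace K E)) Q.degree := by
    rw [← hN, Int.gcd_natCast_natCast] at hgcd
    rw [hQ]
    exact Nat.Coprime.symm hgcd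
  have hlt : ∀ {a b : ℕ}, (b : ℤ) ≤ (Fintype.card K : ℤ) + t → a < b →
      τ ^ a • Q ≠ τ ^ b • Q := by
    intro a b hb hab h
    obtain ⟨k, rfl⟩ := Nat.exists_eq_add_of_lt hab
    rw [add_assoc, pow_add, mul_smul] at h
    have hdvd := hτ.card_dvd_of_pow_smul_eq hE hP hcop (MulAction.injective (τ ^ a) h).symm
    -- The difference of the exponents is positive and at most `q + t`, one less than the number of
    -- rational places.
    have := Nat.le_of_dvd (Nat.succ_pos k) hdvd
    omega
  rcases Nat.lt_or_gt_of_ne hij with hij | hij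
  · exact hlt hj hij heq
  · exact hlt hi hij heq.symm
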